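/- Let $W$ be a compact Hausdorff finite-dimensional smooth manifold, possibly with boundary or corners. Call a smooth vector field on $W$ a velocity field if it is tangent to the boundary of $W$, and at a corner to every face through it (no condition if $W$ has no boundary); these fields form the Lie algebra of $\mathrm{Diff}(W)$. For a vector field $V$ on $W$ let $\exp(V):W\to W$ be the time-one map of its flow: $\exp(V)(w)=\gamma(1)$, where $\gamma:\mathbb R\to W$ is the integral curve of $V$ with $\gamma(0)=w$. Let $V_1,\dots,V_p$ ($p\ge 0$) be velocity fields on $W$ that commute, i.e. their Lie brackets satisfy $[V_m,V_n]=0$ for all $m\ne n$. Let $f_0:S\to W$ be a baseline deformation ($S$ may be any set and $f_0$ any map). Then: 1. For all real numbers $\delta^1,\dots,\delta^p$, $a$ and every $m$, the fields $\sum_{m}\delta^m V_m$ and $aV_m$ have through every point of $W$ exactly one integral curve defined on all of $\mathbb R$, so that their exponentials are well defined. 2. For all real numbers $\delta^1,\dots,\delta^p$, as maps $S\to W$, $$\exp\Big(\sum_{m=1}^p \delta^m V_m\Big)\circ f_0=\exp(\delta^pV_p)\circ\cdots\circ\exp(\delta^1V_1)\circ f_0 .$$ 3. Let the covariates be possibly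 space-varying, $\tau_0,\tau_k:W\to\mathbb R^p$, let $\Delta\tau_k^m(w)=\tau_k^m(w)-\tau_0^m(w)$ be the shift of the $m$-th covariate from the baseline at the location $w$, and let $f_k(s)=\exp\big(\sum_{m}\Delta\tau_k^m V_m\big)(f_0(s))$ be the total deformation driven by $\tau_k$, where the numbers $\Delta\tau_k^m=\Delta\tau_k^m(f_0(s))$ are the shifts at the baseline position of $s$. Then for every $s\in S$, with the same numbers $\Delta\tau_k^m$, $$f_k(s)=\big(\exp(\Delta\tau_k^pV_p)\circ\cdots\circ\exp(\Delta\tau_k^1V_1)\big)(f_0(s)).$$ -/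

import Mathlib

open scoped Manifold ContDiff

noncomputable section

/-- `V` is a velocity field on the manifold `W`, possibly with boundary or corners: an element of the
Lie algebra of the group of diffeomorphisms of `W`. It is a smooth vector field which at every
point is the velocity of some two-sided curve in `W` through that point. The second condition is
automatic at interior points; at a boundary point it says that `V` is tangent to the boundary
(at a corner: to every face through the corner). -/
structure IsVelocityField {E : Type*} [NormedAddCommGroup E] [NormedSpace ℝ E]
    {H : Type*} [TopologicalSpace H] (I : ModelWithCorners ℝ E H)
    {W : Type*} [TopologicalSpace W] [ChartedSpace H W] [IsManifold I ∞ W]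
    (V : (w : W) → TangentSpace I w) : Prop where
  smooth : ContMDiff I I.tangent ∞ (fun w => (⟨w, V w⟩ : TangentBundle I W))
  tangent : ∀ w : W, ∃ γ : ℝ → W, γ 0 = w ∧
    HasMFDerivAt 𝓘(ℝ, ℝ) I γ 0 ((1 : ℝ →L[ℝ] ℝ).smulRight (V (γ 0)))

/-- Through every point of `W` there is exactly one integral curve of `V` defined for all times,
so that the flow of `V` is a well-defined map `ℝ × W → W`. -/
def GeneratesFlow {E : Type*} [NormedAddCommGroup E] [NormedSpace ℝ E]
    {H : Type*} [TopologicalSpace H] (I : ModelWithCorners ℝ E H)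
    {W : Type*} [TopologicalSpace W] [ChartedSpace H W]
    (V : (w : W) → TangentSpace I w) : Prop :=
  ∀ w : W, ∃! γ : ℝ → W, γ 0 = w ∧ IsMIntegralCurve (I := I) γ V

open Classical in
/-- The exponential map `exp V : W → W`, the time-one map of the flow of `V`: it sends `w` to
`γ 1`, where `γ` is the integral curve of `V` with `γ 0 = w` (and to `w` if there is no such curve
defined for all times). -/
def vfExp {E : Type*} [NormedAddCommGroup E] [NormedSpace ℝ E]
    {H : Type*} [TopologicalSpace H] (I : ModelWithCorners ℝ E H)
    {W : Type*} [TopologicalSpace W] [ChartedSpace H W]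
    (V : (w : W) → TangentSpace I w) (w : W) : W :=
  if h : ∃ γ : ℝ → W, γ 0 = w ∧ IsMIntegralCurve (I := I) γ V then h.choose 1 else w

/-- The sequential composition `h (p - 1) ∘ ⋯ ∘ h 1 ∘ h 0`; the map with index `0` acts first. -/
def seqComp {W : Type*} : (p : ℕ) → (Fin p → W → W) → W → W
  | 0, _ => id
  | p + 1, h => h (Fin.last p) ∘ seqComp p (fun m => h m.castSucc)

/-- The relative deformation `exp (∑ m, δ m • V m)` of `W` caused by a simultaneous shift of all
covariates by the amounts `δ`. -/
def relDeformation {E : Type*} [NormedAddCommGroup E] [NormedSpace ℝ E]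
    {H : Type*} [TopologicalSpace H] (I : ModelWithCorners ℝ E H)
    {W : Type*} [TopologicalSpace W] [ChartedSpace H W]
    {p : ℕ} (V : Fin p → (w : W) → TangentSpace I w) (δ : Fin p → ℝ) : W → W :=
  vfExp I (fun w => ∑ m, δ m • V m w)

/-- The relative deformation `exp (a • V m)` of `W` caused by a shift of the `m`-th covariate
alone by the amount `a`. -/
def channelDeformation {E : Type*} [NormedAddCommGroup E] [NormedSpace ℝ E]
    {H : Type*} [TopologicalSpace H] (I : ModelWithCorners ℝ E H)
    {W : Type*} [TopologicalSpace W] [ChartedSpace H W]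
    {p : ℕ} (V : Fin p → (w : W) → TangentSpace I w) (m : Fin p) (a : ℝ) : W → W :=
  vfExp I (fun w => a • V m w)

/-- The total spatial deformation driven by the covariates `τ`, starting from the baseline
deformation `f₀` with covariates `τ₀`. The covariates may vary over `W`; the location `s` is moved
by the relative deformation for the shift `τ - τ₀` observed at the baseline position `f₀ s`. -/
def totalDeformation {E : Type*} [NormedAddCommGroup E] [NormedSpace ℝ E]
    {H : Type*} [TopologicalSpace H] (I : ModelWithCorners ℝ E H)
    {W : Type*} [TopologicalSpace W] [ChartedSpace H W]
    {p : ℕ} (V : Fin p → (w : W) → TangentSpace I w) {S : Type*} (f₀ : S → W)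
    (τ₀ τ : W → Fin p → ℝ) (s : S) : W :=
  relDeformation I V (τ (f₀ s) - τ₀ (f₀ s)) (f₀ s)

end

open Set Filter Metric VectorField
open scoped Topology NNReal

section ConvexInvariance

variable {F : Type*} [NormedAddCommGroup F] [InnerProductSpace ℝ F]

/-- The metric projection onto a nonempty complete convex set, with its variational inequality. -/
lemma Convex.exists_metricProjection {C : Set F} (hconv : Convex ℝ C) (hne : C.Nonempty)
    (hC : IsComplete C) :
    ∃ P : F → F, LipschitzWith 1 P ∧ (∀ u, P u ∈ C) ∧
      ∀ u, ∀ w ∈ C, inner ℝ (u - P u) (w - P u) ≤ 0 := by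
  choose P hPC hP using exists_norm_eq_iInf_of_complete_convex hne hC hconv
  have hP' : ∀ u, ∀ w ∈ C, inner ℝ (u - P u) (w - P u) ≤ 0 := fun u =>
    (norm_eq_iInf_iff_real_inner_le_zero hconv (hPC u)).1 (hP u)
  refine ⟨P, LipschitzWith.of_dist_le_mul fun u v => ?_, hPC, hP'⟩
  have h₁ := hP' u (P v) (hPC v)
  have h₂ := hP' v (P u) (hPC u)
  have key : ‖P u - P v‖ ^ 2 ≤ inner ℝ (u - v) (P u - P v) := by
    have e₁ : u - P u = (u - v) - (P u - P v) + (v - P v) := by abel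
    have e₂ : P v - P u = -(P u - P v) := by abel
    rw [e₁, e₂, inner_neg_right, inner_add_left, inner_sub_left, real_inner_self_eq_norm_sq] at h₁
    linarith
  have hcs := real_inner_le_norm (u - v) (P u - P v)
  rw [dist_eq_norm, dist_eq_norm, NNReal.coe_one, one_mul]
  by_contra! h
  have := norm_nonneg (u - v)
  nlinarith

/-- A curve starting in a closed convex set whose velocity never points away from the projection of
the curve onto the set stays in the set. -/
lemma mem_of_inner_sub_projection_nonpos {C : Set F} {P : F → F} (hP : Continuous P)
    (hPC : ∀ u, P u ∈ C) (hvar : ∀ u, ∀ w ∈ C, inner ℝ (u - P u) (w - P u) ≤ 0)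
    {γ γ' : ℝ → F} {b : ℝ} (h0 : γ 0 ∈ C) (hγ : ContinuousOn γ (Icc 0 b))
    (hderiv : ∀ t ∈ Ico 0 b, HasDerivWithinAt γ (γ' t) (Ici t) t)
    (hdir : ∀ t ∈ Ico 0 b, inner ℝ (γ t - P (γ t)) (γ' t) ≤ 0) :
    ∀ t ∈ Icc 0 b, γ t ∈ C := by
  have hfix : ∀ u ∈ C, P u = u := fun u hu => by
    have := hvar u u hu
    rw [real_inner_self_nonpos] at this
    exact (sub_eq_zero.1 this).symm
  have hmin : ∀ u, ∀ w ∈ C, ‖u - P u‖ ≤ ‖u - w‖ := fun u w hw => by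
    have h₁ := hvar u w hw
    have e : u - w = (u - P u) - (w - P u) := by abel
    have h₂ := norm_sub_sq_real (u - P u) (w - P u)
    rw [← e] at h₂
    have h₃ := sq_nonneg ‖w - P u‖
    exact le_of_sq_le_sq (by linarith) (norm_nonneg _)
  have hle : ∀ t ∈ Icc 0 b, ‖γ t - P (γ t)‖ ^ 2 ≤ 0 := by
    refine image_le_of_liminf_slope_right_le_deriv_boundary (B := fun _ => 0) (B' := fun _ => 0)
      ?_ ?_ continuousOn_const (fun _ _ => hasDerivWithinAt_const _ _ _) ?_
    · exact ((hγ.sub (hP.comp_continuousOn hγ)).norm).pow 2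
    · simp [hfix _ h0]
    · intro t ht r hr
      have hd : HasDerivWithinAt (fun z => ‖γ z - P (γ t)‖ ^ 2)
          (2 * inner ℝ (γ t - P (γ t)) (γ' t)) (Ici t) t :=
        ((hderiv t ht).sub_const _).norm_sq
      have hd' := ((hasDerivWithinAt_iff_tendsto_slope' self_notMem_Ioi).1
        (hd.mono Ioi_subset_Ici_self)).eventually_lt_const (u := r) (by linarith [hdir t ht])
      refine (hd'.and self_mem_nhdsWithin).frequently.mono fun z hz => lt_of_le_of_lt ?_ hz.1
      rw [slope_def_field, slope_def_field]
      have hz' : 0 < z - t := sub_pos.2 hz.2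
      gcongr
      exact hmin _ _ (hPC _)
  intro t ht
  have h := pow_eq_zero_iff two_ne_zero |>.1 (le_antisymm (hle t ht) (sq_nonneg _))
  rw [norm_eq_zero, sub_eq_zero] at h
  rw [h]
  exact hPC _

end ConvexInvariance

section LocalFlow

/-- A linear functional which is maximal on `C` at `x` vanishes on the field `f` at `x`: the field
is tangent to `C` in both directions. -/
def TangentToAt {E : Type*} [NormedAddCommGroup E] [NormedSpace ℝ E] (C : Set E) (f : E → E)
    (x : E) : Prop :=
  ∀ ℓ : E →L[ℝ] ℝ, (∀ y ∈ C, ℓ y ≤ ℓ x) → ℓ (f x) = 0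

lemma IsPicardLindelof.exists_hasDerivWithinAt_mem_closedBall {E : Type*} [NormedAddCommGroup E]
    [NormedSpace ℝ E] [CompleteSpace E] {f : ℝ → E → E} {tmin tmax : ℝ} {t₀ : Icc tmin tmax}
    {x₀ x : E} {a r L K : ℝ≥0} (hf : IsPicardLindelof f t₀ x₀ a r L K)
    (hx : x ∈ closedBall x₀ r) :
    ∃ α : ℝ → E, α t₀ = x ∧ ∀ t ∈ Icc tmin tmax,
      α t ∈ closedBall x₀ a ∧ HasDerivWithinAt α (f t (α t)) (Icc tmin tmax) t := by
  obtain ⟨α, hα⟩ := ODE.FunSpace.exists_isFixedPt_next hf hx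
  refine ⟨α.compProj, by rw [ODE.FunSpace.compProj_val, ← hα, ODE.FunSpace.next_apply₀],
    fun t ht ↦ ⟨α.compProj_mem_closedBall hf.mul_max_le, ?_⟩⟩
  apply ODE.hasDerivWithinAt_picard_Icc t₀.2 hf.continuousOn_uncurry
    α.continuous_compProj.continuousOn (fun _ ht' ↦ α.compProj_mem_closedBall hf.mul_max_le)
    x ht |>.congr_of_mem _ ht
  intro t' ht'
  nth_rw 1 [← hα]
  rw [ODE.FunSpace.compProj_of_mem ht', ODE.FunSpace.next_apply]

variable {E : Type*} [NormedAddCommGroup E] [NormedSpace ℝ E] [FiniteDimensional ℝ E]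

/-- Local flow of a Lipschitz field tangent to a closed convex set. -/
lemma exists_local_flow_of_tangentToAt {C U : Set E} (hconv : Convex ℝ C) (hC : IsClosed C)
    {x₀ : E} (hx₀ : x₀ ∈ C) (hU : U ∈ 𝓝[C] x₀) {f : E → E} {K : ℝ≥0}
    (hf : LipschitzOnWith K f U) (htan : ∀ x ∈ U, TangentToAt C f x) :
    ∃ ε > 0, ∃ r > 0, ∀ x ∈ C ∩ ball x₀ r, ∃ γ : ℝ → E, γ 0 = x ∧
      ∀ t ∈ Ioo (-ε) ε, γ t ∈ C ∩ U ∧ HasDerivAt γ (f (γ t)) t := by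
  let e : E ≃L[ℝ] EuclideanSpace ℝ (Fin (Module.finrank ℝ E)) := toEuclidean
  have hCe : IsClosed (e '' C) := e.toHomeomorph.isClosed_image.2 hC
  obtain ⟨Q, hQ, hQC, hQvar⟩ := Convex.exists_metricProjection
    (hconv.linear_image e.toLinearEquiv.toLinearMap) ⟨_, mem_image_of_mem _ hx₀⟩ hCe.isComplete
  replace hQC : ∀ u, Q u ∈ e '' C := hQC
  replace hQvar : ∀ u, ∀ w ∈ C, inner ℝ (u - Q u) (e w - Q u) ≤ 0 :=
    fun u w hw => hQvar u _ (mem_image_of_mem _ hw)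
  set P : E → E := fun x => e.symm (Q (e x)) with hPdef
  have heP : ∀ x, e (P x) = Q (e x) := fun x => e.apply_symm_apply _
  have hPC : ∀ x, P x ∈ C := fun x => by
    obtain ⟨y, hy, hye⟩ := hQC (e x)
    change e.symm _ ∈ C
    rwa [← hye, e.symm_apply_apply]
  have hPfix : ∀ x ∈ C, P x = x := fun x hx => by
    have h := hQvar (e x) x hx
    rw [real_inner_self_nonpos, sub_eq_zero] at h
    simp [hPdef, ← h]
  have hP : ∃ M : ℝ≥0, LipschitzWith M P :=
    ⟨_, e.symm.lipschitz.comp (hQ.comp e.lipschitz)⟩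
  obtain ⟨M, hM⟩ := hP
  -- a closed ball on which `f ∘ P` is Lipschitz
  have hPU : ∀ᶠ x in 𝓝 x₀, P x ∈ U := by
    have : Tendsto P (𝓝 x₀) (𝓝[C] x₀) := by
      refine tendsto_nhdsWithin_iff.2 ⟨?_, Eventually.of_forall hPC⟩
      have := hM.continuous.tendsto x₀
      rwa [hPfix x₀ hx₀] at this
    exact this hU
  obtain ⟨a, ha, haU⟩ := Metric.nhds_basis_closedBall.mem_iff.1 hPU
  lift a to ℝ≥0 using ha.le
  set g : E → E := f ∘ P with hgdef
  have hg : LipschitzOnWith (K * M) g (closedBall x₀ a) :=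
    hf.comp (hM.lipschitzOnWith) (fun x hx => haU hx)
  obtain ⟨L, hL⟩ : ∃ L : ℝ≥0, ∀ x ∈ closedBall x₀ (a : ℝ), ‖g x‖ ≤ L := by
    obtain ⟨L, hL⟩ := (isCompact_closedBall x₀ (a : ℝ)).exists_bound_of_continuousOn hg.continuousOn
    exact ⟨L.toNNReal, fun x hx => (hL x hx).trans (Real.le_coe_toNNReal L)⟩
  have ha0 : (0 : ℝ) < a := ha
  have hε0 : (0 : ℝ) < a / 2 / (L + 1) := by positivity
  set ε : ℝ := a / 2 / (L + 1) with hεdef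
  have hLε : (L : ℝ) * ε ≤ a / 2 := by
    rw [hεdef, mul_div_assoc', div_le_iff₀ (by positivity)]
    nlinarith [L.2]
  have hPL : IsPicardLindelof (fun _ => g) (tmin := -ε) (tmax := ε) ⟨0, by simp [hε0.le]⟩
      x₀ a (a / 2) L (K * M) := by
    refine IsPicardLindelof.of_time_independent hL hg ?_
    simp only [sub_zero, zero_sub, neg_neg, max_self]
    push_cast
    linarith
  -- one-sided invariance
  have hinv : ∀ (σ : ℝ) (α : ℝ → E), α 0 ∈ C →
      (∀ t ∈ Icc (-ε) ε, α t ∈ closedBall x₀ (a : ℝ) ∧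
        HasDerivWithinAt α (σ • g (α t)) (Icc (-ε) ε) t) → ∀ t ∈ Icc 0 ε, α t ∈ C := by
    intro σ α h0 hα t ht
    have hsub : Icc 0 ε ⊆ Icc (-ε) ε := Icc_subset_Icc_left (by linarith)
    have hmem := mem_of_inner_sub_projection_nonpos (γ := e ∘ α)
      (γ' := fun t => e (σ • g (α t))) (b := ε) hQ.continuous hQC
      (fun u w hw => by obtain ⟨w, hw, rfl⟩ := hw; exact hQvar u w hw)
      (mem_image_of_mem _ h0)
      (fun t ht => (e.continuous.continuousAt.comp_continuousWithinAt
        ((hα t (hsub ht)).2.continuousWithinAt)).mono hsub)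
      (fun t ht => by
        have := (hα t (hsub (Ico_subset_Icc_self ht))).2
        have h2 : HasDerivWithinAt α (σ • g (α t)) (Ici t) t :=
          this.mono_of_mem_nhdsWithin (mem_of_superset (Icc_mem_nhdsGE ht.2)
            (Icc_subset_Icc_left (by linarith [ht.1])))
        exact e.hasFDerivAt.comp_hasDerivWithinAt t h2)
      (fun t ht => by
        have hU' := haU (hα t (hsub (Ico_subset_Icc_self ht))).1
        have h := htan (P (α t)) hU'
          ((innerSL ℝ (e (α t) - Q (e (α t)))).comp (e : E →L[ℝ] _)) (fun y hy => by
            have := hQvar (e (α t)) y hy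
            rw [inner_sub_right] at this
            simp only [ContinuousLinearMap.comp_apply, innerSL_apply_apply,
              ContinuousLinearEquiv.coe_coe, heP]
            linarith)
        simp only [ContinuousLinearMap.comp_apply, innerSL_apply_apply,
          ContinuousLinearEquiv.coe_coe] at h
        simp [hgdef, inner_smul_right, h])
      t ht
    obtain ⟨y, hy, hye⟩ := hmem
    rwa [← e.injective hye]
  refine ⟨ε, hε0, a / 2, by positivity, fun x hx => ?_⟩
  obtain ⟨γ, hγ0, hγ⟩ := hPL.exists_hasDerivWithinAt_mem_closedBall
    (x := x) (by simpa using (ball_subset_closedBall hx.2))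
  replace hγ0 : γ 0 = x := hγ0
  have hmaps : MapsTo (fun t : ℝ => -t) (Icc (-ε) ε) (Icc (-ε) ε) := fun t ht =>
    ⟨neg_le_neg ht.2, neg_le.1 ht.1⟩
  have hγC : ∀ t ∈ Icc (-ε) ε, γ t ∈ C := by
    intro t ht
    rcases le_total 0 t with h | h
    · exact hinv 1 γ (hγ0 ▸ hx.1) (by simpa using hγ) t ⟨h, ht.2⟩
    · have := hinv (-1) (fun t => γ (-t)) (by simpa [hγ0] using hx.1) (fun s hs =>
        ⟨(hγ _ (hmaps hs)).1, by
          have := (hγ _ (hmaps hs)).2.scomp s (hasDerivWithinAt_neg s _) hmaps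
          simpa [Function.comp_def] using this⟩) (-t) ⟨by linarith, by linarith [ht.1]⟩
      simpa using this
  refine ⟨γ, hγ0, fun t ht => ?_⟩
  have ht' := Ioo_subset_Icc_self ht
  have hU' : P (γ t) ∈ U := haU (hγ t ht').1
  have hd := (hγ t ht').2.hasDerivAt (Icc_mem_nhds ht.1 ht.2)
  simp only [hgdef, Function.comp_apply, hPfix _ (hγC t ht')] at hd hU'
  exact ⟨⟨hγC t ht', hU'⟩, hd⟩

end LocalFlow

section PushForward

open Asymptotics

variable {E : Type*} [NormedAddCommGroup E] [NormedSpace ℝ E]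

/-- The flow of `f` transports the commuting field `g`: infinitesimal version, forward in time. -/
lemma hasDerivAt_trajectory_of_commute_of_nonneg {B : Set E} (hB : Convex ℝ B) {f g : E → E}
    {f' g' : E → E →L[ℝ] E} {K M : ℝ≥0}
    (hf : ∀ y ∈ B, HasFDerivWithinAt f (f' y) B y) (hg : ∀ y ∈ B, HasFDerivWithinAt g (g' y) B y)
    (hK : ∀ y ∈ B, ‖f' y‖₊ ≤ K) (hM : LipschitzOnWith M f' B)
    (hcomm : ∀ y ∈ B, f' y (g y) = g' y (f y)) {z : ℝ → ℝ → E} {b : ℝ} (hb : 0 ≤ b)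
    (hz : ∀ᶠ h in 𝓝 0, ∀ s ∈ Icc 0 b, z h s ∈ B ∧ HasDerivAt (z h) (f (z h s)) s)
    (h0 : HasDerivAt (fun h => z h 0) (g (z 0 0)) 0) :
    HasDerivAt (fun h => z h b) (g (z 0 b)) 0 := by
  have hK1 : (0 : ℝ) < K + 1 := by positivity
  have hLip : LipschitzOnWith K f B := hB.lipschitzOnWith_of_nnnorm_hasFDerivWithin_le hf hK
  have hz0 := hz.self_of_nhds
  -- bounds along the trajectories
  have hbound : ∀ᶠ h in 𝓝 (0 : ℝ), ‖z h b - z 0 b - h • g (z 0 b)‖ ≤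
      gronwallBound ‖z h 0 - z 0 0 - h • g (z 0 0)‖ (K + 1)
        (M * (‖z h 0 - z 0 0‖ * Real.exp (K * b)) ^ 2) b := by
    filter_upwards [hz] with h hzh
    have hdist : ∀ s ∈ Icc 0 b, ‖z h s - z 0 s‖ ≤ ‖z h 0 - z 0 0‖ * Real.exp (K * b) := by
      intro s hs
      have := dist_le_of_trajectories_ODE_of_mem (v := fun _ => f) (s := fun _ => B) (K := K)
        (fun _ _ => hLip) (fun s hs => (hzh s hs).2.continuousAt.continuousWithinAt)
        (fun s hs => (hzh s (Ico_subset_Icc_self hs)).2.hasDerivWithinAt)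
        (fun s hs => (hzh s (Ico_subset_Icc_self hs)).1)
        (fun s hs => (hz0 s hs).2.continuousAt.continuousWithinAt)
        (fun s hs => (hz0 s (Ico_subset_Icc_self hs)).2.hasDerivWithinAt)
        (fun s hs => (hz0 s (Ico_subset_Icc_self hs)).1) (dist_eq_norm _ _).le s hs
      rw [dist_eq_norm, sub_zero] at this
      refine this.trans ?_
      gcongr
      exact hs.2
    have hderiv : ∀ s ∈ Icc 0 b, HasDerivWithinAt (fun s => z h s - z 0 s - h • g (z 0 s))
        (f (z h s) - f (z 0 s) - h • g' (z 0 s) (f (z 0 s))) (Icc 0 b) s := by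
      intro s hs
      refine (((hzh s hs).2.sub (hz0 s hs).2).hasDerivWithinAt).sub
        (HasDerivWithinAt.const_smul h ?_)
      exact (hg _ (hz0 s hs).1).comp_hasDerivWithinAt s (hz0 s hs).2.hasDerivWithinAt
        (fun t ht => (hz0 t ht).1)
    have := norm_le_gronwallBound_of_norm_deriv_right_le (K := K + 1)
      (ε := M * (‖z h 0 - z 0 0‖ * Real.exp (K * b)) ^ 2)
      (fun s hs => (hderiv s hs).continuousWithinAt)
      (fun s hs => (hderiv s (Ico_subset_Icc_self hs)).mono_of_mem_nhdsWithin
        (mem_of_superset (Icc_mem_nhdsGE hs.2) (Icc_subset_Icc_left hs.1)))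
      le_rfl (fun s hs => ?_) b (right_mem_Icc.2 hb)
    · rwa [sub_zero] at this
    · replace hs := Ico_subset_Icc_self hs
      set y := z 0 s
      set y' := z h s
      have hy := (hz0 s hs).1
      have hy' := (hzh s hs).1
      have hTaylor : ‖f y' - f y - f' y (y' - y)‖ ≤ (M * ‖y' - y‖) * ‖y' - y‖ := by
        refine Convex.norm_image_sub_le_of_norm_hasFDerivWithin_le'
          (s := B ∩ closedBall y ‖y' - y‖) (f' := f')
          (fun x hx => (hf x hx.1).mono inter_subset_left) (fun x hx => ?_)
          (hB.inter (convex_closedBall _ _)) ⟨hy, by simp⟩ ⟨hy', by simp [dist_eq_norm]⟩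
        rw [← dist_eq_norm]
        exact (hM.dist_le_mul _ hx.1 _ hy).trans (by gcongr; exact hx.2)
      have hsplit : f y' - f y - h • g' y (f y) =
          (f y' - f y - f' y (y' - y)) + f' y (y' - y - h • g y) := by
        rw [map_sub _ (y' - y), map_smul, hcomm y hy]
        abel
      have hd := hdist s hs
      calc ‖f y' - f y - h • g' y (f y)‖
          ≤ ‖f y' - f y - f' y (y' - y)‖ + ‖f' y (y' - y - h • g y)‖ := by
            rw [hsplit]; exact norm_add_le _ _
        _ ≤ M * ‖y' - y‖ * ‖y' - y‖ + (K + 1) * ‖y' - y - h • g y‖ := by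
            gcongr
            refine ((f' y).le_opNorm _).trans ?_
            gcongr
            exact (show ‖f' y‖ ≤ K from hK y hy).trans (by linarith)
        _ ≤ (K + 1) * ‖y' - y - h • g y‖ + M * (‖z h 0 - z 0 0‖ * Real.exp (K * b)) ^ 2 := by
            rw [add_comm, mul_assoc, ← sq]
            gcongr
  rw [hasDerivAt_iff_isLittleO] at h0 ⊢
  simp only [sub_zero] at h0 ⊢
  have hO : (fun h => z h 0 - z 0 0) =O[𝓝 0] fun h : ℝ => h := by
    have : (fun h : ℝ => h • g (z 0 0)) =O[𝓝 0] fun h : ℝ => h :=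
      IsBigO.of_bound ‖g (z 0 0)‖ (Eventually.of_forall fun h => by
        rw [norm_smul, mul_comm])
    simpa using h0.isBigO.add this
  have ho2 : (fun h => ‖z h 0 - z 0 0‖ ^ 2) =o[𝓝 0] fun h : ℝ => h := by
    have h1 := (hO.norm_left.pow 2)
    exact h1.trans_isLittleO (by simpa using isLittleO_pow_id (𝕜 := ℝ) (n := 2) (by norm_num))
  refine IsBigO.trans_isLittleO
    (g := fun h => gronwallBound ‖z h 0 - z 0 0 - h • g (z 0 0)‖ (K + 1)
        (M * (‖z h 0 - z 0 0‖ * Real.exp (K * b)) ^ 2) b)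
    (IsBigO.of_bound 1 (hbound.mono fun h hh => ?_)) ?_
  · rw [one_mul]
    exact hh.trans (le_abs_self _)
  · simp only [gronwallBound_of_K_ne_0 hK1.ne']
    have h1 := h0.norm_left.const_mul_left (Real.exp ((K + 1) * b))
    have h2 := ho2.const_mul_left
      (M * Real.exp (K * b) ^ 2 / (K + 1) * (Real.exp ((K + 1) * b) - 1))
    refine (h1.add h2).congr_left fun h => ?_
    ring

/-- Time reversal of a trajectory. -/
lemma HasDerivAt.comp_neg_of_autonomous {f : E → E} {z : ℝ → E} {s : ℝ}
    (h : HasDerivAt z (f (z (-s))) (-s)) :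
    HasDerivAt (fun s => z (-s)) ((-f) (z (-s))) s := by
  simpa [Function.comp_def] using h.scomp s (hasDerivAt_neg s)

/-- The flow of `f` transports the commuting field `g`: infinitesimal version. -/
lemma hasDerivAt_trajectory_of_commute {B : Set E} (hB : Convex ℝ B) {f g : E → E}
    {f' g' : E → E →L[ℝ] E} {K M : ℝ≥0}
    (hf : ∀ y ∈ B, HasFDerivWithinAt f (f' y) B y) (hg : ∀ y ∈ B, HasFDerivWithinAt g (g' y) B y)
    (hK : ∀ y ∈ B, ‖f' y‖₊ ≤ K) (hM : LipschitzOnWith M f' B)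
    (hcomm : ∀ y ∈ B, f' y (g y) = g' y (f y)) {z : ℝ → ℝ → E} {ε : ℝ}
    (hz : ∀ᶠ h in 𝓝 0, ∀ s ∈ Ioo (-ε) ε, z h s ∈ B ∧ HasDerivAt (z h) (f (z h s)) s)
    (h0 : HasDerivAt (fun h => z h 0) (g (z 0 0)) 0) {s : ℝ} (hs : s ∈ Ioo (-ε) ε) :
    HasDerivAt (fun h => z h s) (g (z 0 s)) 0 := by
  rcases le_total 0 s with hs0 | hs0
  · exact hasDerivAt_trajectory_of_commute_of_nonneg hB hf hg hK hM hcomm hs0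
      (hz.mono fun h hh t ht => hh t ⟨by linarith [hs.1, hs.2, ht.1], ht.2.trans_lt hs.2⟩) h0
  · have := hasDerivAt_trajectory_of_commute_of_nonneg (f := -f) (f' := -f') (g := g) (g' := g')
      (K := K) (M := M) (z := fun h s => z h (-s)) (b := -s) hB (fun y hy => (hf y hy).neg) hg
      (fun y hy => by simpa using hK y hy)
      (LipschitzOnWith.of_dist_le_mul fun x hx y hy => by
        simpa [dist_neg_neg] using hM.dist_le_mul x hx y hy)
      (fun y hy => by simp [hcomm y hy]) (by linarith)
      (hz.mono fun h hh t ht => by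
        have := hh (-t) ⟨by linarith [hs.1, ht.2], by linarith [hs.1, ht.1, hs.2]⟩
        exact ⟨this.1, this.2.comp_neg_of_autonomous⟩)
      (by simpa using h0)
    simpa using this

/-- Two trajectories of a Lipschitz field separate at most exponentially, in both time directions. -/
lemma norm_sub_le_of_trajectories {B : Set E} {f : E → E} {K : ℝ≥0} (hf : LipschitzOnWith K f B)
    {z w : ℝ → E} {ε : ℝ} (hz : ∀ s ∈ Ioo (-ε) ε, z s ∈ B ∧ HasDerivAt z (f (z s)) s)
    (hw : ∀ s ∈ Ioo (-ε) ε, w s ∈ B ∧ HasDerivAt w (f (w s)) s) {s : ℝ} (hs : s ∈ Ioo (-ε) ε) :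
    ‖z s - w s‖ ≤ ‖z 0 - w 0‖ * Real.exp (K * ε) := by
  have key : ∀ (f : E → E) (z w : ℝ → E), LipschitzOnWith K f B →
      (∀ s ∈ Ioo (-ε) ε, z s ∈ B ∧ HasDerivAt z (f (z s)) s) →
      (∀ s ∈ Ioo (-ε) ε, w s ∈ B ∧ HasDerivAt w (f (w s)) s) → ∀ s ∈ Ioo (-ε) ε, 0 ≤ s →
      ‖z s - w s‖ ≤ ‖z 0 - w 0‖ * Real.exp (K * ε) := by
    intro f z w hf hz hw s hs hs0
    have hsub : Icc 0 s ⊆ Ioo (-ε) ε := fun t ht =>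
      ⟨by linarith [ht.1, ht.2, hs.1, hs.2], ht.2.trans_lt hs.2⟩
    have := dist_le_of_trajectories_ODE_of_mem (v := fun _ => f) (s := fun _ => B) (K := K)
      (fun _ _ => hf) (fun t ht => (hz t (hsub ht)).2.continuousAt.continuousWithinAt)
      (fun t ht => (hz t (hsub (Ico_subset_Icc_self ht))).2.hasDerivWithinAt)
      (fun t ht => (hz t (hsub (Ico_subset_Icc_self ht))).1)
      (fun t ht => (hw t (hsub ht)).2.continuousAt.continuousWithinAt)
      (fun t ht => (hw t (hsub (Ico_subset_Icc_self ht))).2.hasDerivWithinAt)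
      (fun t ht => (hw t (hsub (Ico_subset_Icc_self ht))).1) (dist_eq_norm _ _).le s
      (right_mem_Icc.2 hs0)
    rw [dist_eq_norm, sub_zero] at this
    refine this.trans ?_
    gcongr
    exact hs.2.le
  have hneg : ∀ {z : ℝ → E}, (∀ s ∈ Ioo (-ε) ε, z s ∈ B ∧ HasDerivAt z (f (z s)) s) →
      ∀ s ∈ Ioo (-ε) ε, z (-s) ∈ B ∧ HasDerivAt (fun s => z (-s)) ((-f) (z (-s))) s :=
    fun hz s hs => by
      have := hz (-s) ⟨neg_lt_neg hs.2, by linarith [hs.1]⟩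
      exact ⟨this.1, this.2.comp_neg_of_autonomous⟩
  rcases le_total 0 s with hs0 | hs0
  · exact key f z w hf hz hw s hs hs0
  · simpa using key (-f) (fun s => z (-s)) (fun s => w (-s))
      (LipschitzOnWith.of_dist_le_mul fun x hx y hy => by
        simpa [dist_neg_neg] using hf.dist_le_mul x hx y hy) (hneg hz) (hneg hw) (-s)
      ⟨neg_lt_neg hs.2, by linarith [hs.1]⟩ (by linarith)

/-- Following the trajectories of `f` for time `h`, from an initial point moving with velocity `v`,
adds up the velocities at `h = 0`. -/
lemma hasDerivAt_trajectory_diagonal {B : Set E} {f : E → E} {K : ℝ≥0}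
    (hf : LipschitzOnWith K f B) {z : ℝ → ℝ → E} {ε : ℝ} (hε : 0 < ε)
    (hz : ∀ᶠ h in 𝓝 0, ∀ s ∈ Ioo (-ε) ε, z h s ∈ B ∧ HasDerivAt (z h) (f (z h s)) s)
    {v : E} (h0 : HasDerivAt (fun h => z h 0) v 0) :
    HasDerivAt (fun h => z h h) (v + f (z 0 0)) 0 := by
  have hz0 := hz.self_of_nhds
  have h0mem : (0 : ℝ) ∈ Ioo (-ε) ε := ⟨neg_lt_zero.2 hε, hε⟩
  have hrem : HasDerivAt (fun h => z h h - z 0 h - (z h 0 - z 0 0)) 0 0 := by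
    rw [hasDerivAt_iff_isLittleO]
    simp only [sub_self, sub_zero, smul_zero]
    have hbd : ∀ᶠ h in 𝓝 (0 : ℝ), ‖z h h - z 0 h - (z h 0 - z 0 0)‖ ≤
        ‖(K * (‖z h 0 - z 0 0‖ * Real.exp (K * ε))) * h‖ := by
      filter_upwards [hz, Ioo_mem_nhds h0mem.1 h0mem.2] with h hzh hh
      have := (convex_Ioo (-ε) ε).norm_image_sub_le_of_norm_hasDerivWithin_le
        (f := fun s => z h s - z 0 s) (C := K * (‖z h 0 - z 0 0‖ * Real.exp (K * ε)))
        (fun s hs => ((hzh s hs).2.sub (hz0 s hs).2).hasDerivWithinAt)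
        (fun s hs => by
          rw [← dist_eq_norm]
          refine (hf.dist_le_mul _ (hzh s hs).1 _ (hz0 s hs).1).trans ?_
          gcongr
          rw [dist_eq_norm]
          exact norm_sub_le_of_trajectories hf hzh hz0 hs) h0mem hh
      rw [sub_zero] at this
      rwa [norm_mul, Real.norm_of_nonneg (by positivity)]
    refine IsBigO.trans_isLittleO
      (g := fun h : ℝ => K * (‖z h 0 - z 0 0‖ * Real.exp (K * ε)) * h)
      (IsBigO.of_bound 1 (hbd.mono fun h hh => by rwa [one_mul])) ?_
    have ht : Tendsto (fun h => K * (‖z h 0 - z 0 0‖ * Real.exp (K * ε))) (𝓝 0) (𝓝 0) := by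
      have := (((h0.sub_const (z 0 0)).continuousAt.norm.mul_const
        (Real.exp (K * ε))).const_mul (K : ℝ)).tendsto
      simpa using this
    simpa using ((isLittleO_one_iff ℝ).2 ht).mul_isBigO (isBigO_refl (fun h : ℝ => h) (𝓝 0))
  have := (hrem.add (hz0 0 h0mem).2).add (h0.sub_const (z 0 0))
  rw [zero_add, add_comm (f _) v] at this
  refine this.congr_of_eventuallyEq (Eventually.of_forall fun h => ?_)
  simp only [Pi.add_apply]
  abel

end PushForward

section ChartField

variable {E : Type*} [NormedAddCommGroup E] [NormedSpace ℝ E]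
  {H : Type*} [TopologicalSpace H] {I : ModelWithCorners ℝ E H}
  {W : Type*} [TopologicalSpace W] [ChartedSpace H W]

/-- The expression of a vector field in the extended chart at `x₀`. -/
noncomputable def chartField (I : ModelWithCorners ℝ E H) (V : (w : W) → TangentSpace I w) (x₀ : W) :
    E → E :=
  mpullbackWithin 𝓘(ℝ, E) I (extChartAt I x₀).symm V (range I)

lemma chartField_add (V V' : (w : W) → TangentSpace I w) (x₀ : W) :
    chartField I (V + V') x₀ = chartField I V x₀ + chartField I V' x₀ :=
  mpullbackWithin_add

lemma chartField_smul (c : ℝ) (V : (w : W) → TangentSpace I w) (x₀ : W) :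
    chartField I (c • V) x₀ = c • chartField I V x₀ :=
  mpullbackWithin_const_smul

variable [IsManifold I ∞ W]

lemma contDiffWithinAt_chartField [CompleteSpace E] {V : (w : W) → TangentSpace I w}
    (hV : ContMDiff I I.tangent ∞ (fun w => (⟨w, V w⟩ : TangentBundle I W))) {x₀ : W} {y : E}
    (hy : y ∈ (extChartAt I x₀).target) :
    ContDiffWithinAt ℝ ∞ (chartField I V x₀) (range I) y := by
  rw [← contMDiffWithinAt_iff_contDiffWithinAt]
  have := ContMDiffWithinAt.mpullbackWithin_vectorField (t := univ)
    (hV.contMDiffAt (x := (extChartAt I x₀).symm y)).contMDiffWithinAt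
    (contMDiffWithinAt_extChartAt_symm_range (n := ∞) x₀ hy)
    (isInvertible_mfderivWithin_extChartAt_symm hy)
    (extChartAt_target_subset_range x₀ hy) I.uniqueMDiffOn (by simp) (mapsTo_univ _ _)
  exact (contMDiff_snd_tangentBundle_modelSpace E 𝓘(ℝ, E)).contMDiffAt.comp_contMDiffWithinAt _ this

lemma mfderivWithin_extChartAt_symm_mpullbackWithin (V : (w : W) → TangentSpace I w) {x₀ : W} {y : E}
    (hy : y ∈ (extChartAt I x₀).target) :
    mfderivWithin 𝓘(ℝ, E) I (extChartAt I x₀).symm (range I) y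
      (mpullbackWithin 𝓘(ℝ, E) I (extChartAt I x₀).symm V (range I) y) =
      V ((extChartAt I x₀).symm y) :=
  (isInvertible_mfderivWithin_extChartAt_symm (I := I) hy).self_apply_inverse _

lemma mfderiv_extChartAt_eq_mpullbackWithin (V : (w : W) → TangentSpace I w) {x₀ : W} {y : E}
    (hy : y ∈ (extChartAt I x₀).target) :
    mfderiv I 𝓘(ℝ, E) (extChartAt I x₀) ((extChartAt I x₀).symm y) (V ((extChartAt I x₀).symm y)) =
      mpullbackWithin 𝓘(ℝ, E) I (extChartAt I x₀).symm V (range I) y := by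
  rw [← mfderivWithin_extChartAt_symm_mpullbackWithin V hy]
  exact DFunLike.congr_fun (mfderiv_extChartAt_comp_mfderivWithin_extChartAt_symm (I := I) hy) _

lemma HasMFDerivAt.hasDerivAt_extChartAt_comp {V : (w : W) → TangentSpace I w} {γ : ℝ → W} {t : ℝ}
    (hγ : HasMFDerivAt 𝓘(ℝ, ℝ) I γ t ((1 : ℝ →L[ℝ] ℝ).smulRight (V (γ t)))) {x₀ : W}
    (hx₀ : γ t ∈ (extChartAt I x₀).source) :
    HasDerivAt (fun s => extChartAt I x₀ (γ s))
      (chartField I V x₀ (extChartAt I x₀ (γ t))) t := by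
  have h := HasMFDerivAt.comp t
    (mdifferentiableAt_extChartAt (I := I) (by simpa using hx₀)).hasMFDerivAt hγ
  have hval := mfderiv_extChartAt_eq_mpullbackWithin V ((extChartAt I x₀).map_source hx₀)
  rw [(extChartAt I x₀).left_inv hx₀] at hval
  let A : E →L[ℝ] E := mfderiv I 𝓘(ℝ, E) (extChartAt I x₀) (γ t)
  let v : E := V (γ t)
  have h' : HasFDerivAt (fun s => extChartAt I x₀ (γ s)) (A.comp ((1 : ℝ →L[ℝ] ℝ).smulRight v)) t :=
    h.hasFDerivAt
  refine h'.hasDerivAt.congr_deriv ?_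
  have : (A.comp ((1 : ℝ →L[ℝ] ℝ).smulRight v)) 1 = A v := by simp
  exact this.trans hval

lemma HasDerivAt.hasMFDerivAt_extChartAt_symm_comp {V : (w : W) → TangentSpace I w} {x₀ : W}
    {u : ℝ → E} {t : ℝ} (hu : HasDerivAt u (chartField I V x₀ (u t)) t)
    (hmem : ∀ᶠ s in 𝓝 t, u s ∈ (extChartAt I x₀).target) :
    HasMFDerivAt 𝓘(ℝ, ℝ) I (fun s => (extChartAt I x₀).symm (u s)) t
      ((1 : ℝ →L[ℝ] ℝ).smulRight (V ((extChartAt I x₀).symm (u t)))) := by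
  have ht := hmem.self_of_nhds
  have h := (mdifferentiableWithinAt_extChartAt_symm (I := I) ht).hasMFDerivWithinAt
  have hu' : HasFDerivAt u ((1 : ℝ →L[ℝ] ℝ).smulRight (chartField I V x₀ (u t))) t :=
    hu.hasFDerivAt
  have hc := (HasMFDerivWithinAt.comp (s := u ⁻¹' range I) t h
    hu'.hasMFDerivAt.hasMFDerivWithinAt subset_rfl).hasMFDerivAt
    (hmem.mono fun s hs => extChartAt_target_subset_range x₀ hs)
  have hval := mfderivWithin_extChartAt_symm_mpullbackWithin V ht
  let A : E →L[ℝ] E := mfderivWithin 𝓘(ℝ, E) I (extChartAt I x₀).symm (range I) (u t)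
  have heq : A.comp ((1 : ℝ →L[ℝ] ℝ).smulRight (chartField I V x₀ (u t))) =
      (1 : ℝ →L[ℝ] ℝ).smulRight (A (chartField I V x₀ (u t))) := by
    ext; simp
  replace hval : A (chartField I V x₀ (u t)) = V ((extChartAt I x₀).symm (u t)) := hval
  rw [hval] at heq
  exact heq ▸ hc

lemma lieBracketWithin_chartField_eq_zero [CompleteSpace E] {V V' : (w : W) → TangentSpace I w}
    (hV : ContMDiff I I.tangent ∞ (fun w => (⟨w, V w⟩ : TangentBundle I W)))
    (hV' : ContMDiff I I.tangent ∞ (fun w => (⟨w, V' w⟩ : TangentBundle I W)))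
    (hcomm : ∀ w, mlieBracket I V V' w = 0) {x₀ : W} {y : E}
    (hy : y ∈ (extChartAt I x₀).target) :
    lieBracketWithin ℝ (chartField I V x₀) (chartField I V' x₀) (range I) y = 0 := by
  have : IsManifold I (minSmoothness ℝ 2) W := by
    rw [minSmoothness_of_isRCLikeNormedField]; infer_instance
  have h := mpullbackWithin_mlieBracketWithin (I := 𝓘(ℝ, E)) (I' := I) (V := V) (W := V')
    (f := (extChartAt I x₀).symm) (s := range I) (t := univ) (x₀ := y) (n := ∞)
    ((hV.mdifferentiable (by simp)).mdifferentiableAt.mdifferentiableWithinAt)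
    ((hV'.mdifferentiable (by simp)).mdifferentiableAt.mdifferentiableWithinAt)
    I.uniqueMDiffOn (contMDiffWithinAt_extChartAt_symm_range x₀ hy)
    (extChartAt_target_subset_range x₀ hy) (by rw [minSmoothness_of_isRCLikeNormedField]; exact WithTop.coe_le_coe.2 le_top) (by simp)
    (I.range_subset_closure_interior (extChartAt_target_subset_range x₀ hy))
  rw [mlieBracketWithin_eq_lieBracketWithin] at h
  rw [chartField, chartField, ← h, mpullbackWithin_apply, mlieBracketWithin_univ, hcomm]
  exact map_zero _

end ChartField

section TangentField

variable {E : Type*} [NormedAddCommGroup E] [NormedSpace ℝ E]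
  {H : Type*} [TopologicalSpace H] {I : ModelWithCorners ℝ E H}
  {W : Type*} [TopologicalSpace W] [ChartedSpace H W] [IsManifold I ∞ W]

/-- A smooth vector field whose expression in every chart is tangent to the model convex set: the
linear form of `IsVelocityField`, stable under linear combinations. -/
structure IsTangentField {E : Type*} [NormedAddCommGroup E] [NormedSpace ℝ E]
    {H : Type*} [TopologicalSpace H] (I : ModelWithCorners ℝ E H)
    {W : Type*} [TopologicalSpace W] [ChartedSpace H W] [IsManifold I ∞ W]
    (V : (w : W) → TangentSpace I w) : Prop where
  smooth : ContMDiff I I.tangent ∞ (fun w => (⟨w, V w⟩ : TangentBundle I W))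
  tangentToAt : ∀ x₀ : W, ∀ y ∈ (extChartAt I x₀).target,
    TangentToAt (range I) (chartField I V x₀) y

variable {V V' : (w : W) → TangentSpace I w}

lemma IsVelocityField.isTangentField (hV : IsVelocityField I V) : IsTangentField I V := by
  refine ⟨hV.smooth, fun x₀ y hy ℓ hℓ => ?_⟩
  obtain ⟨γ, hγ0, hγ⟩ := hV.tangent ((extChartAt I x₀).symm y)
  have hsrc : γ 0 ∈ (extChartAt I x₀).source := hγ0 ▸ (extChartAt I x₀).map_target hy
  have hy0 : extChartAt I x₀ (γ 0) = y := by rw [hγ0, (extChartAt I x₀).right_inv hy]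
  have hd := ℓ.hasFDerivAt.comp_hasDerivAt (0 : ℝ) (hγ.hasDerivAt_extChartAt_comp hsrc)
  rw [hy0] at hd
  refine IsLocalMax.hasDerivAt_eq_zero ?_ hd
  refine Eventually.of_forall fun t => ?_
  simp only [Function.comp_apply, hy0]
  exact hℓ _ (by simp)

lemma IsTangentField.add (hV : IsTangentField I V) (hV' : IsTangentField I V') :
    IsTangentField I (V + V') where
  smooth := hV.smooth.add_section hV'.smooth
  tangentToAt x₀ y hy ℓ hℓ := by
    rw [chartField_add, Pi.add_apply, map_add, hV.tangentToAt x₀ y hy ℓ hℓ,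
      hV'.tangentToAt x₀ y hy ℓ hℓ, add_zero]

lemma IsTangentField.smul (c : ℝ) (hV : IsTangentField I V) : IsTangentField I (c • V) where
  smooth := hV.smooth.const_smul_section
  tangentToAt x₀ y hy ℓ hℓ := by
    rw [chartField_smul, Pi.smul_apply, map_smul, hV.tangentToAt x₀ y hy ℓ hℓ, smul_zero]

lemma IsTangentField.zero : IsTangentField I (0 : (w : W) → TangentSpace I w) where
  smooth := Bundle.contMDiff_zeroSection ℝ (TangentSpace I)
  tangentToAt x₀ y hy ℓ hℓ := by
    rw [chartField, mpullbackWithin_zero, Pi.zero_apply]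
    exact map_zero ℓ

lemma IsTangentField.sum {ι : Type*} {s : Finset ι} {V : ι → (w : W) → TangentSpace I w}
    (hV : ∀ i ∈ s, IsTangentField I (V i)) : IsTangentField I (∑ i ∈ s, V i) :=
  Finset.sum_induction _ _ (fun _ _ => IsTangentField.add) IsTangentField.zero hV

end TangentField

section LocalTheory

variable {E : Type*} [NormedAddCommGroup E] [NormedSpace ℝ E]
  {H : Type*} [TopologicalSpace H] {I : ModelWithCorners ℝ E H}
  {W : Type*} [TopologicalSpace W] [ChartedSpace H W] [IsManifold I ∞ W]
  {V V' : (w : W) → TangentSpace I w}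

/-- Near a point, the expression of a smooth field in a chart has bounded and Lipschitz derivative
on a convex set. -/
lemma exists_ball_chartField_fderivWithin [CompleteSpace E]
    (hV : ContMDiff I I.tangent ∞ (fun w => (⟨w, V w⟩ : TangentBundle I W))) (x₀ : W) :
    ∃ ρ > 0, ∃ K M : ℝ≥0, range I ∩ ball (extChartAt I x₀ x₀) ρ ⊆ (extChartAt I x₀).target ∧
      (∀ y ∈ range I ∩ ball (extChartAt I x₀ x₀) ρ,
        ‖fderivWithin ℝ (chartField I V x₀) (range I) y‖₊ ≤ K) ∧
      LipschitzOnWith M (fderivWithin ℝ (chartField I V x₀) (range I))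
        (range I ∩ ball (extChartAt I x₀ x₀) ρ) := by
  have hx₀ := mem_extChartAt_target (I := I) x₀
  have hx₀r := extChartAt_target_subset_range x₀ hx₀
  have hd : ContDiffWithinAt ℝ 1 (fderivWithin ℝ (chartField I V x₀) (range I)) (range I)
      (extChartAt I x₀ x₀) :=
    (contDiffWithinAt_chartField hV hx₀).fderivWithin_right I.uniqueDiffOn
      (WithTop.coe_le_coe.2 le_top) hx₀r
  obtain ⟨M, t, ht, hM⟩ := hd.exists_lipschitzOnWith I.convex_range
  have hcont := hd.continuousWithinAt.nnnorm
  set K := ‖fderivWithin ℝ (chartField I V x₀) (range I) (extChartAt I x₀ x₀)‖₊ + 1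
  have hK : ∀ᶠ y in 𝓝[range I] (extChartAt I x₀ x₀),
      ‖fderivWithin ℝ (chartField I V x₀) (range I) y‖₊ ≤ K :=
    (hcont.eventually_lt_const (lt_add_one _)).mono fun _ h => h.le
  obtain ⟨ρ, hρ, hsub⟩ := Metric.mem_nhdsWithin_iff.1
    (inter_mem (inter_mem ht hK) (extChartAt_target_mem_nhdsWithin x₀))
  rw [inter_comm] at hsub
  exact ⟨ρ, hρ, K, M, fun y hy => (hsub hy).2, fun y hy => (hsub hy).1.2,
    hM.mono fun y hy => (hsub hy).1.1⟩

lemma hasFDerivWithinAt_chartField [CompleteSpace E]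
    (hV : ContMDiff I I.tangent ∞ (fun w => (⟨w, V w⟩ : TangentBundle I W))) {x₀ : W} {y : E}
    (hy : y ∈ (extChartAt I x₀).target) {B : Set E} (hB : B ⊆ range I) :
    HasFDerivWithinAt (chartField I V x₀) (fderivWithin ℝ (chartField I V x₀) (range I) y) B y :=
  (((contDiffWithinAt_chartField hV hy).differentiableWithinAt (by simp)).hasFDerivWithinAt).mono hB

lemma exists_ball_chartField_lipschitz [CompleteSpace E]
    (hV : ContMDiff I I.tangent ∞ (fun w => (⟨w, V w⟩ : TangentBundle I W))) (x₀ : W) :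
    ∃ ρ > 0, ∃ K : ℝ≥0, range I ∩ ball (extChartAt I x₀ x₀) ρ ⊆ (extChartAt I x₀).target ∧
      LipschitzOnWith K (chartField I V x₀) (range I ∩ ball (extChartAt I x₀ x₀) ρ) := by
  obtain ⟨ρ, hρ, K, M, hsub, hK, -⟩ := exists_ball_chartField_fderivWithin hV x₀
  exact ⟨ρ, hρ, K, hsub,
    (I.convex_range.inter (convex_ball _ _)).lipschitzOnWith_of_nnnorm_hasFDerivWithin_le
    (fun y hy => hasFDerivWithinAt_chartField hV (hsub hy) inter_subset_left) hK⟩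

/-- Solutions of a tangent field in a chart, staying in a prescribed neighborhood. -/
lemma IsTangentField.exists_chart_trajectories [FiniteDimensional ℝ E] (hV : IsTangentField I V)
    (x₀ : W) {ρ : ℝ} (hρ : 0 < ρ) :
    ∃ ε > 0, ∃ N : Set W, IsOpen N ∧ x₀ ∈ N ∧ N ⊆ (extChartAt I x₀).source ∧ ∀ w ∈ N,
      ∃ u : ℝ → E, u 0 = extChartAt I x₀ w ∧ ∀ t ∈ Ioo (-ε) ε,
        u t ∈ range I ∩ ball (extChartAt I x₀ x₀) ρ ∧ u t ∈ (extChartAt I x₀).target ∧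
        HasDerivAt u (chartField I V x₀ (u t)) t := by
  have : CompleteSpace E := FiniteDimensional.complete ℝ E
  obtain ⟨r, hr, K, hsub, hK⟩ := exists_ball_chartField_lipschitz hV.smooth x₀
  set y₀ := extChartAt I x₀ x₀
  have hU : range I ∩ ball y₀ (min r ρ) ∈ 𝓝[range I] y₀ :=
    inter_mem_nhdsWithin _ (ball_mem_nhds _ (lt_min hr hρ))
  have hmono : range I ∩ ball y₀ (min r ρ) ⊆ range I ∩ ball y₀ r :=
    inter_subset_inter_right _ (ball_subset_ball (min_le_left _ _))
  obtain ⟨ε, hε, δ, hδ, hflow⟩ := exists_local_flow_of_tangentToAt I.convex_range I.isClosed_range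
    (extChartAt_target_subset_range x₀ (mem_extChartAt_target x₀)) hU (hK.mono hmono)
    (fun y hy => hV.tangentToAt x₀ y (hsub (hmono hy)))
  refine ⟨ε, hε, (extChartAt I x₀).source ∩ extChartAt I x₀ ⁻¹' ball y₀ δ,
    (continuousOn_extChartAt x₀).isOpen_inter_preimage (isOpen_extChartAt_source x₀) isOpen_ball,
    ⟨mem_extChartAt_source x₀, mem_ball_self hδ⟩, inter_subset_left, fun w hw => ?_⟩
  obtain ⟨u, hu0, hu⟩ := hflow (extChartAt I x₀ w) ⟨by simp, hw.2⟩
  refine ⟨u, hu0, fun t ht => ⟨?_, hsub (hmono (hu t ht).1.2), (hu t ht).2⟩⟩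
  exact ⟨(hu t ht).1.1, ball_subset_ball (min_le_right _ _) (hu t ht).1.2.2⟩

/-- Local uniqueness of integral curves, boundary points included. -/
lemma integralCurve_eventuallyEq [CompleteSpace E]
    (hV : ContMDiff I I.tangent ∞ (fun w => (⟨w, V w⟩ : TangentBundle I W))) {γ γ' : ℝ → W} {t₀ : ℝ}
    (hγ : ∀ᶠ t in 𝓝 t₀, HasMFDerivAt 𝓘(ℝ, ℝ) I γ t ((1 : ℝ →L[ℝ] ℝ).smulRight (V (γ t))))
    (hγ' : ∀ᶠ t in 𝓝 t₀, HasMFDerivAt 𝓘(ℝ, ℝ) I γ' t ((1 : ℝ →L[ℝ] ℝ).smulRight (V (γ' t))))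
    (h : γ t₀ = γ' t₀) : γ =ᶠ[𝓝 t₀] γ' := by
  obtain ⟨ρ, hρ, K, hsub, hK⟩ := exists_ball_chartField_lipschitz hV (γ t₀)
  set x₀ := γ t₀ with hx₀
  have key : ∀ {c : ℝ → W}, c t₀ = x₀ →
      (∀ᶠ t in 𝓝 t₀, HasMFDerivAt 𝓘(ℝ, ℝ) I c t ((1 : ℝ →L[ℝ] ℝ).smulRight (V (c t)))) →
      ∀ᶠ t in 𝓝 t₀, c t ∈ (extChartAt I x₀).source ∧
        HasDerivAt (fun t => extChartAt I x₀ (c t)) (chartField I V x₀ (extChartAt I x₀ (c t))) t ∧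
        extChartAt I x₀ (c t) ∈ range I ∩ ball (extChartAt I x₀ x₀) ρ := by
    intro c hc0 hc
    have hcont : ContinuousAt c t₀ := hc.self_of_nhds.continuousAt
    have hN : (extChartAt I x₀).source ∩ extChartAt I x₀ ⁻¹' ball (extChartAt I x₀ x₀) ρ ∈ 𝓝 x₀ :=
      inter_mem (extChartAt_source_mem_nhds x₀)
        ((continuousAt_extChartAt x₀).preimage_mem_nhds (ball_mem_nhds _ hρ))
    filter_upwards [hc, hcont.preimage_mem_nhds (by rwa [hc0])] with t ht hmem
    exact ⟨hmem.1, ht.hasDerivAt_extChartAt_comp hmem.1, by simp, hmem.2⟩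
  have h₁ := key rfl hγ
  have h₂ := key h.symm hγ'
  have heq := ODE_solution_unique_of_eventually (v := fun _ => chartField I V x₀)
    (s := fun _ => range I ∩ ball (extChartAt I x₀ x₀) ρ) (K := K) (.of_forall fun _ => hK)
    (h₁.mono fun _ ht => ht.2) (h₂.mono fun _ ht => ht.2) (congrArg (extChartAt I x₀) h)
  filter_upwards [heq, h₁, h₂] with t ht h₁ h₂
  exact (extChartAt I x₀).injOn h₁.1 h₂.1 ht

/-- Uniqueness of integral curves on open intervals, boundary points included. -/
lemma integralCurve_eqOn [CompleteSpace E] [T2Space W]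
    (hV : ContMDiff I I.tangent ∞ (fun w => (⟨w, V w⟩ : TangentBundle I W))) {γ γ' : ℝ → W}
    {s : Set ℝ} (hs : IsOpen s) (hs' : IsPreconnected s)
    (hγ : ∀ t ∈ s, HasMFDerivAt 𝓘(ℝ, ℝ) I γ t ((1 : ℝ →L[ℝ] ℝ).smulRight (V (γ t))))
    (hγ' : ∀ t ∈ s, HasMFDerivAt 𝓘(ℝ, ℝ) I γ' t ((1 : ℝ →L[ℝ] ℝ).smulRight (V (γ' t))))
    {t₀ : ℝ} (ht₀ : t₀ ∈ s) (h : γ t₀ = γ' t₀) : EqOn γ γ' s := by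
  suffices hsub : s ⊆ {t | γ t = γ' t} ∩ s from fun t ht => (hsub ht).1
  refine hs'.subset_of_closure_inter_subset ?_ ⟨t₀, ht₀, h, ht₀⟩ ?_
  · rw [isOpen_iff_mem_nhds]
    rintro t ⟨hteq, ht⟩
    have hnhds := hs.mem_nhds ht
    exact inter_mem (integralCurve_eventuallyEq hV (eventually_of_mem hnhds hγ)
      (eventually_of_mem hnhds hγ') hteq) hnhds
  · rintro t ⟨htcl, ht⟩
    refine ⟨?_, ht⟩
    exact tendsto_nhds_unique_of_frequently_eq (hγ t ht).continuousAt (hγ' t ht).continuousAt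
      ((mem_closure_iff_frequently.1 htcl).mono fun _ h => h.1)

end LocalTheory

section GlobalFlow

variable {E : Type*} [NormedAddCommGroup E] [NormedSpace ℝ E]
  {H : Type*} [TopologicalSpace H] {I : ModelWithCorners ℝ E H}
  {W : Type*} [TopologicalSpace W] [ChartedSpace H W]

/-- A positive constant that exists locally exists uniformly on a compact space. -/
lemma exists_pos_forall_of_local {X : Type*} [TopologicalSpace X] [CompactSpace X]
    {P : X → ℝ → Prop} (hmono : ∀ x ε ε', ε' ≤ ε → P x ε → P x ε')
    (hloc : ∀ x, ∃ ε > 0, ∃ N ∈ 𝓝 x, ∀ y ∈ N, P y ε) : ∃ ε > 0, ∀ x, P x ε := by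
  have := isCompact_univ.induction_on (p := fun s : Set X => ∃ ε > 0, ∀ x ∈ s, P x ε)
    ⟨1, one_pos, by simp⟩ (fun s t hst ⟨ε, hε, h⟩ => ⟨ε, hε, fun x hx => h x (hst hx)⟩)
    (fun s t ⟨ε, hε, h⟩ ⟨ε', hε', h'⟩ => ⟨min ε ε', lt_min hε hε', fun x hx =>
      hx.elim (fun hx => hmono _ _ _ (min_le_left _ _) (h x hx))
        (fun hx => hmono _ _ _ (min_le_right _ _) (h' x hx))⟩)
    (fun x _ => by
      obtain ⟨ε, hε, N, hN, h⟩ := hloc x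
      exact ⟨N, mem_nhdsWithin_of_mem_nhds hN, ε, hε, h⟩)
  simpa using this

lemma HasMFDerivAt.comp_add_const {γ : ℝ → W} {t c : ℝ} {w : W} {v : TangentSpace I w}
    (h : HasMFDerivAt 𝓘(ℝ, ℝ) I γ (t + c) ((1 : ℝ →L[ℝ] ℝ).smulRight v)) :
    HasMFDerivAt 𝓘(ℝ, ℝ) I (fun s => γ (s + c)) t ((1 : ℝ →L[ℝ] ℝ).smulRight v) := by
  have h1 : HasFDerivAt (fun s : ℝ => s + c) (ContinuousLinearMap.id ℝ ℝ) t :=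
    (hasFDerivAt_id t).add_const c
  exact HasMFDerivAt.comp t h h1.hasMFDerivAt

variable [IsManifold I ∞ W] [T2Space W] {V : (w : W) → TangentSpace I w}

/-- If integral curves through all points exist for times in `(-a, a)`, they exist for times in
`(-3a/2, 3a/2)`. -/
lemma exists_integralCurve_extend [CompleteSpace E]
    (hV : ContMDiff I I.tangent ∞ (fun w => (⟨w, V w⟩ : TangentBundle I W))) {a : ℝ} (ha : 0 < a)
    (h : ∀ w : W, ∃ γ : ℝ → W, γ 0 = w ∧ ∀ t ∈ Ioo (-a) a,
      HasMFDerivAt 𝓘(ℝ, ℝ) I γ t ((1 : ℝ →L[ℝ] ℝ).smulRight (V (γ t)))) (w : W) :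
    ∃ γ : ℝ → W, γ 0 = w ∧ ∀ t ∈ Ioo (-(3 / 2 * a)) (3 / 2 * a),
      HasMFDerivAt 𝓘(ℝ, ℝ) I γ t ((1 : ℝ →L[ℝ] ℝ).smulRight (V (γ t))) := by
  choose Γ hΓ0 hΓ using h
  have hshift : ∀ c : ℝ, ∀ t ∈ Ioo (c - a) (c + a), HasMFDerivAt 𝓘(ℝ, ℝ) I
      (fun s => Γ (Γ w c) (s + -c)) t
      ((1 : ℝ →L[ℝ] ℝ).smulRight (V (Γ (Γ w c) (t + -c)))) := fun c t ht =>
    (hΓ (Γ w c) (t + -c) ⟨by linarith [ht.1], by linarith [ht.2]⟩).comp_add_const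
  have hagree : ∀ c ∈ Ioo (-a) a, ∀ t ∈ Ioo (-a) a ∩ Ioo (c - a) (c + a),
      Γ w t = Γ (Γ w c) (t + -c) := fun c hc => by
    refine integralCurve_eqOn hV (isOpen_Ioo.inter isOpen_Ioo)
      (ordConnected_Ioo.inter ordConnected_Ioo).isPreconnected (fun t ht => hΓ w t ht.1)
      (fun t ht => hshift c t ht.2) (t₀ := c) ⟨hc, by constructor <;> linarith⟩ ?_
    simp [hΓ0]
  have hp : a / 2 ∈ Ioo (-a) a := by constructor <;> linarith
  have hm : -(a / 2) ∈ Ioo (-a) a := by constructor <;> linarith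
  let γ : ℝ → W := fun t => if a ≤ t then Γ (Γ w (a / 2)) (t + -(a / 2)) else
    if t ≤ -a then Γ (Γ w (-(a / 2))) (t + -(-(a / 2))) else Γ w t
  have h1 : ∀ t ∈ Ioo (-a) a, γ t = Γ w t := fun t ht => by
    simp only [γ, if_neg (not_le.2 ht.2), if_neg (not_le.2 ht.1)]
  have h2 : ∀ t ∈ Ioo 0 (3 / 2 * a), γ t = Γ (Γ w (a / 2)) (t + -(a / 2)) := fun t ht => by
    rcases le_or_gt a t with hat | hat
    · simp only [γ, if_pos hat]
    · rw [h1 t ⟨by linarith [ht.1], hat⟩]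
      exact hagree _ hp t ⟨⟨by linarith [ht.1], hat⟩, by linarith [ht.1], by linarith [ht.2]⟩
  have h3 : ∀ t ∈ Ioo (-(3 / 2 * a)) 0, γ t = Γ (Γ w (-(a / 2))) (t + -(-(a / 2))) :=
    fun t ht => by
    rcases le_or_gt t (-a) with hat | hat
    · simp only [γ, if_pos hat, if_neg (show ¬ a ≤ t by linarith)]
    · rw [h1 t ⟨hat, by linarith [ht.2]⟩]
      exact hagree _ hm t ⟨⟨hat, by linarith [ht.2]⟩, by linarith [ht.1], by linarith [ht.2]⟩
  have htransfer : ∀ {c : ℝ → W} {l u : ℝ}, (∀ t ∈ Ioo l u, γ t = c t) → ∀ t ∈ Ioo l u,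
      HasMFDerivAt 𝓘(ℝ, ℝ) I c t ((1 : ℝ →L[ℝ] ℝ).smulRight (V (c t))) →
      HasMFDerivAt 𝓘(ℝ, ℝ) I γ t ((1 : ℝ →L[ℝ] ℝ).smulRight (V (γ t))) := by
    intro c l u hc t ht hd
    rw [hc t ht]
    exact hd.congr_of_eventuallyEq (eventually_of_mem (Ioo_mem_nhds ht.1 ht.2) hc)
  refine ⟨γ, by rw [h1 0 ⟨by linarith, ha⟩, hΓ0], fun t ht => ?_⟩
  rcases lt_or_ge (-a) t with hl | hl
  · rcases lt_or_ge t a with hu | hu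
    · exact htransfer h1 t ⟨hl, hu⟩ (hΓ w t ⟨hl, hu⟩)
    · exact htransfer h2 t ⟨by linarith, ht.2⟩
        (hshift _ t ⟨by linarith, by linarith [ht.2]⟩)
  · exact htransfer h3 t ⟨ht.1, by linarith⟩ (hshift _ t ⟨by linarith [ht.1], by linarith⟩)

/-- A tangent field on a compact manifold, possibly with boundary or corners, is complete. -/
theorem IsTangentField.generatesFlow [FiniteDimensional ℝ E] [CompactSpace W]
    (hV : IsTangentField I V) : GeneratesFlow I V := by
  have : CompleteSpace E := FiniteDimensional.complete ℝ E
  obtain ⟨ε, hε, hloc⟩ := exists_pos_forall_of_local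
    (P := fun (w : W) ε => ∃ γ : ℝ → W, γ 0 = w ∧ ∀ t ∈ Ioo (-ε) ε,
      HasMFDerivAt 𝓘(ℝ, ℝ) I γ t ((1 : ℝ →L[ℝ] ℝ).smulRight (V (γ t))))
    (fun w ε ε' hle ⟨γ, h0, h⟩ => ⟨γ, h0, fun t ht => h t ⟨by linarith [ht.1], by linarith [ht.2]⟩⟩)
    (fun x₀ => by
      obtain ⟨ε, hε, N, hNo, hxN, hNs, hN⟩ := hV.exists_chart_trajectories x₀ one_pos
      refine ⟨ε, hε, N, hNo.mem_nhds hxN, fun w hw => ?_⟩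
      obtain ⟨u, hu0, hu⟩ := hN w hw
      refine ⟨fun t => (extChartAt I x₀).symm (u t), ?_, fun t ht => ?_⟩
      · simpa only [hu0] using (extChartAt I x₀).left_inv (hNs hw)
      · exact (hu t ht).2.2.hasMFDerivAt_extChartAt_symm_comp
          (eventually_of_mem (Ioo_mem_nhds ht.1 ht.2) fun s hs => (hu s hs).2.1))
  have hn : ∀ n : ℕ, ∀ w : W, ∃ γ : ℝ → W, γ 0 = w ∧
      ∀ t ∈ Ioo (-((3 / 2) ^ n * ε)) ((3 / 2) ^ n * ε),
      HasMFDerivAt 𝓘(ℝ, ℝ) I γ t ((1 : ℝ →L[ℝ] ℝ).smulRight (V (γ t))) := by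
    intro n
    induction n with
    | zero => simpa using hloc
    | succ n ih =>
      rw [pow_succ', mul_assoc]
      exact exists_integralCurve_extend hV.smooth (by positivity) ih
  have hall : ∀ (a : ℝ) (w : W), ∃ γ : ℝ → W, γ 0 = w ∧ ∀ t ∈ Ioo (-a) a,
      HasMFDerivAt 𝓘(ℝ, ℝ) I γ t ((1 : ℝ →L[ℝ] ℝ).smulRight (V (γ t))) := by
    intro a w
    obtain ⟨n, hn'⟩ := pow_unbounded_of_one_lt (a / ε) (by norm_num : (1 : ℝ) < 3 / 2)
    rw [div_lt_iff₀ hε] at hn'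
    obtain ⟨γ, h0, h⟩ := hn n w
    exact ⟨γ, h0, fun t ht => h t ⟨by linarith [ht.1], by linarith [ht.2]⟩⟩
  intro w
  choose Γ hΓ0 hΓ using fun a => hall a w
  have hagree : ∀ a : ℝ, 0 < a → ∀ t ∈ Ioo (-a) a, Γ (|t| + 1) t = Γ a t := by
    intro a ha t ht
    refine integralCurve_eqOn hV.smooth (s := Ioo (-(|t| + 1)) (|t| + 1) ∩ Ioo (-a) a)
      (isOpen_Ioo.inter isOpen_Ioo) (ordConnected_Ioo.inter ordConnected_Ioo).isPreconnected
      (fun s hs => hΓ _ s hs.1) (fun s hs => hΓ _ s hs.2) (t₀ := 0)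
      ⟨⟨by linarith [abs_nonneg t], by positivity⟩, by linarith, ha⟩ (by rw [hΓ0, hΓ0])
      ⟨abs_lt.1 (lt_add_one _), ht⟩
  refine ⟨fun t => Γ (|t| + 1) t, ⟨hΓ0 _, fun t => ?_⟩, fun γ hγ => ?_⟩
  · have ht : t ∈ Ioo (-(|t| + 1)) (|t| + 1) := abs_lt.1 (lt_add_one _)
    exact (hΓ _ t ht).congr_of_eventuallyEq
      (eventually_of_mem (Ioo_mem_nhds ht.1 ht.2) (hagree _ (by positivity)))
  · funext t
    have ht : t ∈ Ioo (-(|t| + 1)) (|t| + 1) := abs_lt.1 (lt_add_one _)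
    exact integralCurve_eqOn hV.smooth isOpen_Ioo isPreconnected_Ioo (fun s _ => hγ.2 s) (hΓ _)
      (t₀ := 0) ⟨by linarith [abs_nonneg t], by positivity⟩ (by rw [hγ.1, hΓ0]) ht

lemma IsMIntegralCurve.eq_of_eq_zero [CompleteSpace E]
    (hV : ContMDiff I I.tangent ∞ (fun w => (⟨w, V w⟩ : TangentBundle I W))) {γ γ' : ℝ → W}
    (hγ : IsMIntegralCurve (I := I) γ V) (hγ' : IsMIntegralCurve (I := I) γ' V)
    (h : γ 0 = γ' 0) : γ = γ' :=
  funext fun t => integralCurve_eqOn hV isOpen_univ isPreconnected_univ (fun t _ => hγ t)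
    (fun t _ => hγ' t) (mem_univ 0) h (mem_univ t)

lemma vfExp_eq [CompleteSpace E]
    (hV : ContMDiff I I.tangent ∞ (fun w => (⟨w, V w⟩ : TangentBundle I W))) {γ : ℝ → W}
    (hγ : IsMIntegralCurve (I := I) γ V) : vfExp I V (γ 0) = γ 1 := by
  have h : ∃ c : ℝ → W, c 0 = γ 0 ∧ IsMIntegralCurve (I := I) c V := ⟨γ, rfl, hγ⟩
  rw [vfExp, dif_pos h, h.choose_spec.2.eq_of_eq_zero hV hγ h.choose_spec.1]

end GlobalFlow

section CommutingFlows

/-- The curve `γ` has velocity `V (γ t)` at time `t`. -/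
def HasVelocityAt {E : Type*} [NormedAddCommGroup E] [NormedSpace ℝ E]
    {H : Type*} [TopologicalSpace H] (I : ModelWithCorners ℝ E H)
    {W : Type*} [TopologicalSpace W] [ChartedSpace H W] (V : (w : W) → TangentSpace I w)
    (γ : ℝ → W) (t : ℝ) : Prop :=
  HasMFDerivAt 𝓘(ℝ, ℝ) I γ t ((1 : ℝ →L[ℝ] ℝ).smulRight (V (γ t)))

lemma hasVelocityAt_of_hasDerivAt_extChartAt_comp {E : Type*} [NormedAddCommGroup E]
    [NormedSpace ℝ E] {H : Type*} [TopologicalSpace H] {I : ModelWithCorners ℝ E H}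
    {W : Type*} [TopologicalSpace W] [ChartedSpace H W] [IsManifold I ∞ W]
    {Z : (w : W) → TangentSpace I w} {x₀ : W} {c : ℝ → W} {t : ℝ}
    (h : HasDerivAt (fun s => extChartAt I x₀ (c s)) (chartField I Z x₀ (extChartAt I x₀ (c t))) t)
    (hsrc : ∀ᶠ s in 𝓝 t, c s ∈ (extChartAt I x₀).source) : HasVelocityAt I Z c t := by
  have h' := HasDerivAt.hasMFDerivAt_extChartAt_symm_comp h
    (hsrc.mono fun s hs => (extChartAt I x₀).map_source hs)
  rw [(extChartAt I x₀).left_inv hsrc.self_of_nhds] at h'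
  exact h'.congr_of_eventuallyEq
    (hsrc.mono fun s hs => ((extChartAt I x₀).left_inv hs).symm)

variable {E : Type*} [NormedAddCommGroup E] [NormedSpace ℝ E] [FiniteDimensional ℝ E]
  {H : Type*} [TopologicalSpace H] {I : ModelWithCorners ℝ E H}
  {W : Type*} [TopologicalSpace W] [ChartedSpace H W] [IsManifold I ∞ W] [T2Space W]
  {X Y Z : (w : W) → TangentSpace I w} {Φ : W → ℝ → W}

lemma flow_add (hY : IsTangentField I Y)
    (hΦ : ∀ w, Φ w 0 = w ∧ IsMIntegralCurve (I := I) (Φ w) Y) (w : W) (s t : ℝ) :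
    Φ (Φ w s) t = Φ w (t + s) := by
  have : CompleteSpace E := FiniteDimensional.complete ℝ E
  refine congrFun (IsMIntegralCurve.eq_of_eq_zero hY.smooth (γ' := fun t => Φ w (t + s))
    (hΦ (Φ w s)).2 (fun t => ((hΦ w).2 (t + s)).comp_add_const) ?_) t
  simp [(hΦ _).1]

/-- Seen in a chart, the flow of a tangent field solves its differential equation inside a
prescribed ball for a uniform time. -/
lemma exists_flow_chart_trajectories (hY : IsTangentField I Y)
    (hΦ : ∀ w, Φ w 0 = w ∧ IsMIntegralCurve (I := I) (Φ w) Y) (x₀ : W) {ρ : ℝ} (hρ : 0 < ρ) :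
    ∃ ε > 0, ∃ N : Set W, IsOpen N ∧ x₀ ∈ N ∧ N ⊆ (extChartAt I x₀).source ∧ ∀ w ∈ N,
      ∀ t ∈ Ioo (-ε) ε, Φ w t ∈ (extChartAt I x₀).source ∧
        extChartAt I x₀ (Φ w t) ∈ range I ∩ ball (extChartAt I x₀ x₀) ρ ∧
        HasDerivAt (fun t => extChartAt I x₀ (Φ w t))
          (chartField I Y x₀ (extChartAt I x₀ (Φ w t))) t := by
  have : CompleteSpace E := FiniteDimensional.complete ℝ E
  obtain ⟨ε, hε, N, hNo, hxN, hNs, hN⟩ := hY.exists_chart_trajectories x₀ hρ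
  refine ⟨ε, hε, N, hNo, hxN, hNs, fun w hw t ht => ?_⟩
  obtain ⟨u, hu0, hu⟩ := hN w hw
  have heq : EqOn (Φ w) (fun t => (extChartAt I x₀).symm (u t)) (Ioo (-ε) ε) :=
    integralCurve_eqOn hY.smooth isOpen_Ioo isPreconnected_Ioo (fun s _ => (hΦ w).2 s)
      (fun t ht => (hu t ht).2.2.hasMFDerivAt_extChartAt_symm_comp
          (eventually_of_mem (Ioo_mem_nhds ht.1 ht.2) fun s hs => (hu s hs).2.1))
      (t₀ := 0) ⟨neg_lt_zero.2 hε, hε⟩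
      (by rw [(hΦ w).1, hu0, (extChartAt I x₀).left_inv (hNs hw)])
  have hsrc : Φ w t ∈ (extChartAt I x₀).source := by
    rw [heq ht]
    exact (extChartAt I x₀).map_target (hu t ht).2.1
  refine ⟨hsrc, ?_, ((hΦ w).2 t).hasDerivAt_extChartAt_comp hsrc⟩
  rw [heq ht, (extChartAt I x₀).right_inv (hu t ht).2.1]
  exact (hu t ht).1

/-- The flow of `Y` maps `Z` to itself for small times if `[Y, Z] = 0`. -/
lemma exists_hasVelocityAt_flow_of_mlieBracket_eq_zero (hY : IsTangentField I Y)
    (hZ : ContMDiff I I.tangent ∞ (fun w => (⟨w, Z w⟩ : TangentBundle I W)))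
    (hcomm : ∀ w, mlieBracket I Y Z w = 0)
    (hΦ : ∀ w, Φ w 0 = w ∧ IsMIntegralCurve (I := I) (Φ w) Y) (x₀ : W) :
    ∃ ε > 0, ∃ N ∈ 𝓝 x₀, ∀ w ∈ N, ∀ s ∈ Ioo (-ε) ε, ∀ c : ℝ → W, c 0 = w →
      HasVelocityAt I Z c 0 → HasVelocityAt I Z (fun h => Φ (c h) s) 0 := by
  have : CompleteSpace E := FiniteDimensional.complete ℝ E
  obtain ⟨ρ, hρ, K, M, hsub, hK, hM⟩ := exists_ball_chartField_fderivWithin hY.smooth x₀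
  obtain ⟨ε, hε, N, hNo, hxN, hNs, hN⟩ := exists_flow_chart_trajectories hY hΦ x₀ hρ
  refine ⟨ε, hε, N, hNo.mem_nhds hxN, fun w hw s hs c hc0 hc => ?_⟩
  have hcN : ∀ᶠ h in 𝓝 0, c h ∈ N :=
    hc.continuousAt.preimage_mem_nhds (hNo.mem_nhds (by rwa [hc0]))
  refine hasVelocityAt_of_hasDerivAt_extChartAt_comp (x₀ := x₀) ?_
    (hcN.mono fun h hh => (hN _ hh s hs).1)
  refine hasDerivAt_trajectory_of_commute (B := range I ∩ ball (extChartAt I x₀ x₀) ρ)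
    (f := chartField I Y x₀) (g := chartField I Z x₀)
    (z := fun h s => extChartAt I x₀ (Φ (c h) s)) (I.convex_range.inter (convex_ball _ _))
    (fun y hy => hasFDerivWithinAt_chartField hY.smooth (hsub hy) inter_subset_left)
    (fun y hy => hasFDerivWithinAt_chartField hZ (hsub hy) inter_subset_left) hK hM
    (fun y hy => ?_) (hcN.mono fun h hh s hs => (hN _ hh s hs).2) ?_ hs
  · have := lieBracketWithin_chartField_eq_zero hY.smooth hZ hcomm (hsub hy)
    rw [lieBracketWithin, sub_eq_zero] at this
    exact this.symm
  · simp only [(hΦ _).1]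
    exact hc.hasDerivAt_extChartAt_comp (hNs (by rwa [hc0]))

/-- The flow of `Y` maps `Z` to itself if `[Y, Z] = 0`. -/
lemma hasVelocityAt_flow_of_mlieBracket_eq_zero [CompactSpace W] (hY : IsTangentField I Y)
    (hZ : ContMDiff I I.tangent ∞ (fun w => (⟨w, Z w⟩ : TangentBundle I W)))
    (hcomm : ∀ w, mlieBracket I Y Z w = 0)
    (hΦ : ∀ w, Φ w 0 = w ∧ IsMIntegralCurve (I := I) (Φ w) Y) (s : ℝ) {c : ℝ → W}
    (hc : HasVelocityAt I Z c 0) : HasVelocityAt I Z (fun h => Φ (c h) s) 0 := by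
  obtain ⟨ε, hε, huni⟩ := exists_pos_forall_of_local
    (fun w ε ε' hle h s hs => h s ⟨by linarith [hs.1], by linarith [hs.2]⟩)
    (exists_hasVelocityAt_flow_of_mlieBracket_eq_zero hY hZ hcomm hΦ)
  obtain ⟨n, hn⟩ := exists_nat_gt (|s| / ε)
  have hn0 : (0 : ℝ) < n := (div_nonneg (abs_nonneg s) hε.le).trans_lt hn
  have hσ : s / n ∈ Ioo (-ε) ε := by
    rw [mem_Ioo, ← abs_lt, abs_div, Nat.abs_cast, div_lt_iff₀ hn0, mul_comm]
    exact (div_lt_iff₀ hε).1 hn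
  have hk : ∀ k : ℕ, HasVelocityAt I Z (fun h => Φ (c h) (k * (s / n))) 0 := by
    intro k
    induction k with
    | zero => simpa [(hΦ _).1] using hc
    | succ k ih =>
      have := huni _ _ hσ (fun h => Φ (c h) (k * (s / n))) rfl ih
      simp only [flow_add hY hΦ] at this
      rwa [show s / n + k * (s / n) = ((k + 1 : ℕ) : ℝ) * (s / n) by push_cast; ring] at this
  have := hk n
  rwa [mul_div_cancel₀ _ hn0.ne'] at this

/-- Moving a curve with velocity `X` along the flow of `Y` produces the velocity `X + Y`. -/
lemma hasVelocityAt_flow_diagonal (hY : IsTangentField I Y)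
    (hΦ : ∀ w, Φ w 0 = w ∧ IsMIntegralCurve (I := I) (Φ w) Y) {c : ℝ → W}
    (hc : HasVelocityAt I X c 0) : HasVelocityAt I (X + Y) (fun h => Φ (c h) h) 0 := by
  have : CompleteSpace E := FiniteDimensional.complete ℝ E
  obtain ⟨ρ, hρ, K, hsub, hK⟩ := exists_ball_chartField_lipschitz hY.smooth (c 0)
  obtain ⟨ε, hε, N, hNo, hxN, hNs, hN⟩ := exists_flow_chart_trajectories hY hΦ (c 0) hρ
  have hcN : ∀ᶠ h in 𝓝 0, c h ∈ N := hc.continuousAt.preimage_mem_nhds (hNo.mem_nhds hxN)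
  refine hasVelocityAt_of_hasDerivAt_extChartAt_comp (x₀ := c 0) (Z := X + Y) ?_ ?_
  · rw [chartField_add, Pi.add_apply]
    have := hasDerivAt_trajectory_diagonal hK (z := fun h s => extChartAt I (c 0) (Φ (c h) s)) hε
      (hcN.mono fun h hh s hs => (hN _ hh s hs).2) (v := chartField I X (c 0) (extChartAt I (c 0) (c 0)))
      (by simpa only [(hΦ _).1] using hc.hasDerivAt_extChartAt_comp (hNs hxN))
    simpa only [(hΦ _).1] using this
  · filter_upwards [hcN, Ioo_mem_nhds (neg_lt_zero.2 hε) hε] with h hh hε'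
    exact (hN _ hh h hε').1

/-- If `[Y, X] = 0`, moving an integral curve of `X` along the flow of `Y` yields an integral curve
of `X + Y`. -/
lemma isMIntegralCurve_flow_of_mlieBracket_eq_zero [CompactSpace W] (hX : IsTangentField I X)
    (hY : IsTangentField I Y) (hcomm : ∀ w, mlieBracket I Y X w = 0)
    (hΦ : ∀ w, Φ w 0 = w ∧ IsMIntegralCurve (I := I) (Φ w) Y) {x : ℝ → W}
    (hx : IsMIntegralCurve (I := I) x X) :
    IsMIntegralCurve (I := I) (fun t => Φ (x t) t) (X + Y) := by
  have : CompleteSpace E := FiniteDimensional.complete ℝ E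
  have hcomm' : ∀ w, mlieBracket I Y (X + Y) w = 0 := fun w => by
    rw [mlieBracket_add_right (hX.smooth.mdifferentiable (by simp)).mdifferentiableAt
      (hY.smooth.mdifferentiable (by simp)).mdifferentiableAt, hcomm, mlieBracket_self]
    simp
  intro t
  have h1 : HasVelocityAt I X (fun h => x (h + t)) 0 := (hx (0 + t)).comp_add_const
  have h2 := hasVelocityAt_flow_of_mlieBracket_eq_zero hY (hX.add hY).smooth hcomm' hΦ t
    (hasVelocityAt_flow_diagonal hY hΦ h1)
  have h3 : HasVelocityAt I (X + Y) (fun h => Φ (x (h + t)) (t + h)) (t + -t) := by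
    rw [add_neg_cancel]
    simpa only [flow_add hY hΦ] using h2
  have h4 : HasVelocityAt I (X + Y) (fun s => Φ (x (s + -t + t)) (t + (s + -t))) t :=
    h3.comp_add_const
  have e : (fun s => Φ (x (s + -t + t)) (t + (s + -t))) = fun s => Φ (x s) s := by
    funext s
    rw [neg_add_cancel_right, show t + (s + -t) = s by ring]
  rw [e] at h4
  exact h4

/-- The exponential of a sum of two commuting tangent fields. -/
theorem vfExp_add_of_mlieBracket_eq_zero [CompactSpace W] (hX : IsTangentField I X)
    (hY : IsTangentField I Y) (hcomm : ∀ w, mlieBracket I Y X w = 0) (w : W) :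
    vfExp I (X + Y) w = vfExp I Y (vfExp I X w) := by
  have : CompleteSpace E := FiniteDimensional.complete ℝ E
  obtain ⟨x, ⟨hx0, hx⟩, -⟩ := hX.generatesFlow w
  choose Φ hΦ using fun w => (hY.generatesFlow w).exists
  have h1 := vfExp_eq (hX.add hY).smooth
    (isMIntegralCurve_flow_of_mlieBracket_eq_zero hX hY hcomm hΦ hx)
  have h2 := vfExp_eq hX.smooth hx
  have h3 := vfExp_eq hY.smooth (hΦ (x 1)).2
  simp only [(hΦ _).1, hx0] at h1 h2 h3
  rw [h1, h2, h3]

lemma vfExp_zero (w : W) : vfExp I (0 : (w : W) → TangentSpace I w) w = w := by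
  have : CompleteSpace E := FiniteDimensional.complete ℝ E
  refine vfExp_eq (γ := fun _ => w) IsTangentField.zero.smooth fun t => ?_
  have h : (1 : ℝ →L[ℝ] ℝ).smulRight (0 : E) = 0 := by ext; simp
  exact h ▸ hasMFDerivAt_const w t

/-- The exponential of a linear combination of commuting tangent fields. -/
theorem vfExp_sum_smul [CompactSpace W] {p : ℕ} {V : Fin p → (w : W) → TangentSpace I w}
    (hV : ∀ m, IsTangentField I (V m))
    (hcomm : ∀ m n, m ≠ n → ∀ w, mlieBracket I (V m) (V n) w = 0) (δ : Fin p → ℝ) :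
    vfExp I (∑ m, δ m • V m) = seqComp p (fun m => vfExp I (δ m • V m)) := by
  induction p with
  | zero =>
    funext w
    simpa [seqComp] using vfExp_zero w
  | succ p ih =>
    funext w
    have hmd : ∀ (m : Fin (p + 1)) (w : W), MDifferentiableAt I I.tangent
        (fun w => (⟨w, V m w⟩ : TangentBundle I W)) w := fun m w =>
      ((hV m).smooth.mdifferentiable (by simp)).mdifferentiableAt
    set Y := δ (Fin.last p) • V (Fin.last p)
    have hY : IsTangentField I Y := (hV _).smul _
    have hsum : ∀ s : Finset (Fin p), IsTangentField I (∑ m ∈ s, δ m.castSucc • V m.castSucc) ∧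
        ∀ w, mlieBracket I Y (∑ m ∈ s, δ m.castSucc • V m.castSucc) w = 0 := by
      intro s
      refine Finset.sum_induction _ (fun X => IsTangentField I X ∧ ∀ w, mlieBracket I Y X w = 0)
        (fun X X' hX hX' => ⟨hX.1.add hX'.1, fun w => ?_⟩) ⟨IsTangentField.zero, by simp⟩
        (fun m _ => ⟨(hV _).smul _, fun w => ?_⟩)
      · rw [mlieBracket_add_right (hX.1.smooth.mdifferentiable (by simp)).mdifferentiableAt
          (hX'.1.smooth.mdifferentiable (by simp)).mdifferentiableAt, hX.2, hX'.2, add_zero]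
      · rw [mlieBracket_const_smul_right (hmd _ w), mlieBracket_const_smul_left (hmd _ w),
          hcomm _ _ (Fin.castSucc_lt_last m).ne', smul_zero, smul_zero]
    rw [Fin.sum_univ_castSucc, vfExp_add_of_mlieBracket_eq_zero (hsum _).1 hY (hsum _).2,
      ih (fun m => hV _) (fun m n hmn => hcomm _ _ (by simpa using hmn))]
    rfl

end CommutingFlows

theorem proposition1
    {E : Type*} [NormedAddCommGroup E] [NormedSpace ℝ E] [FiniteDimensional ℝ E]
    {H : Type*} [TopologicalSpace H] (I : ModelWithCorners ℝ E H)
    {W : Type*} [TopologicalSpace W] [ChartedSpace H W] [IsManifold I ∞ W]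
    [T2Space W] [CompactSpace W]
    {p : ℕ} (V : Fin p → (w : W) → TangentSpace I w)
    (hV : ∀ m, IsVelocityField I (V m))
    (hcomm : ∀ m n, m ≠ n → ∀ w, VectorField.mlieBracket I (V m) (V n) w = 0)
    {S : Type*} (f₀ : S → W) (τ₀ τₖ : W → Fin p → ℝ) :
    (∀ δ : Fin p → ℝ, GeneratesFlow I (fun w => ∑ m, δ m • V m w)) ∧
    (∀ (m : Fin p) (a : ℝ), GeneratesFlow I (fun w => a • V m w)) ∧
    (∀ δ : Fin p → ℝ,
      relDeformation I V δ ∘ f₀ = seqComp p (fun m => channelDeformation I V m (δ m)) ∘ f₀) ∧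
    (∀ s : S, totalDeformation I V f₀ τ₀ τₖ s =
      seqComp p (fun m => channelDeformation I V m (τₖ (f₀ s) m - τ₀ (f₀ s) m)) (f₀ s)) := by
  have hV' : ∀ m, IsTangentField I (V m) := fun m => (hV m).isTangentField
  have hfun : ∀ δ : Fin p → ℝ, (fun w => ∑ m, δ m • V m w) = ∑ m, δ m • V m := fun δ => by
    funext w
    simp
  have hexp : ∀ δ : Fin p → ℝ,
      relDeformation I V δ = seqComp p (fun m => channelDeformation I V m (δ m)) := fun δ => by
    rw [relDeformation, hfun]
    exact vfExp_sum_smul hV' hcomm δ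
  refine ⟨fun δ => ?_, fun m a => ((hV' m).smul a).generatesFlow, fun δ => by rw [hexp],
    fun s => ?_⟩
  · rw [hfun]
    exact (IsTangentField.sum fun m _ => (hV' m).smul (δ m)).generatesFlow
  · rw [totalDeformation, hexp]
    rfl
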